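/- Let $k$ be a field and $\Lambda = k[x]/(x^4)$. Let $\operatorname{mono}(1\to 2\to 3\to 4,\Lambda)$ be the full subcategory of the category of representations of the quiver $1\to 2\to 3\to 4$ in $\Lambda$-modules whose objects are the sequences $M_1\xrightarrow{h_1} M_2\xrightarrow{h_2} M_3\xrightarrow{h_3} M_4$ of finitely generated $\Lambda$-modules with $h_1,h_2,h_3$ injective $\Lambda$-linear maps. Let $\Gamma$ be the quiver with one vertex and two loops, and let $\operatorname{rep}\Gamma$ be the category of its finite-dimensional representations over $k$. Then $\operatorname{mono}(1\to 2\to 3\to 4,\Lambda)$ is wild in the sense of Drozd, i.e. there exists a $k$-linear faithful exact functor $$F\colon \operatorname{rep}\Gamma\longrightarrow \operatorname{mono}(1\to 2\to 3\to 4,\Lambda)$$ that preserves indecomposables (if $V$ is indecomposable, then so is $F(V)$) and reflects isomorphisms (if $F(V)\cong F(W)$, then $V\cong W$). Here exact means that $F$ sends short exact sequences of representations of $\Gamma$ to sequences that are exact in the abelian category of representations of $1\to 2\to 3\to 4$ over $\Lambda$. -/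

import Mathlib

open CategoryTheory CategoryTheory.Limits
open scoped Polynomial DirectSum

universe u

/-- The vertex set of the linearly oriented quiver `1 → 2 → ⋯ → m`; the vertex called `i + 1`
on paper is the element `i` of `Fin m`. -/
def LinearQuiver (m : ℕ) : Type := Fin m

/-- There is exactly one arrow from each vertex to the next one, and no other arrow. -/
instance LinearQuiver.instQuiver (m : ℕ) : Quiver.{0} (LinearQuiver m) :=
  ⟨fun i j => PLift ((Fin.val (n := m) i) + 1 = (Fin.val (n := m) j))⟩

/-- The quiver with one vertex and two loops. -/
abbrev TwoLoopQuiver : Type := Quiver.SingleObj (Fin 2)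

/-- `rep(Q, Mod Λ)`: the representations of the quiver `Q` by `Λ`-modules. A functor on the path
category of `Q` is the same thing as a family of modules indexed by the vertices with a linear map
for each arrow, and a natural transformation is a family of linear maps compatible with the
arrows. -/
abbrev QuiverRep (Q : Type) [Quiver.{0} Q] (Λ : Type u) [Ring Λ] :=
  Paths Q ⥤ ModuleCat.{u} Λ

namespace QuiverRep

variable {Q : Type} [Quiver.{0} Q] {Λ : Type u} [Ring Λ]

/-- The module `M_i` of a representation at the vertex `i`. -/
abbrev at_ (M : QuiverRep Q Λ) (i : Q) : ModuleCat.{u} Λ := M.obj ((Paths.of Q).obj i)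

/-- The linear map `h_α : M_j → M_i` of a representation along the arrow `α : j → i`. -/
abbrev along (M : QuiverRep Q Λ) {j i : Q} (α : j ⟶ i) : M.at_ j →ₗ[Λ] M.at_ i :=
  (M.map ((Paths.of Q).map α)).hom

open Classical in
/-- The map `h_{i,in} : ⨁_{α, t(α) = i} M_{s(α)} → M_i` with components `h_α`. -/
noncomputable def incoming (M : QuiverRep Q Λ) (i : Q) :
    (⨁ α : (Σ j : Q, (j ⟶ i)), M.at_ α.1) →ₗ[Λ] M.at_ i :=
  DirectSum.toModule Λ (Σ j : Q, (j ⟶ i)) (M.at_ i) (fun α => M.along α.2)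

end QuiverRep

/-- `rep(Q, mod Λ)`: the representations with finitely generated modules at all vertices, as a full
subcategory of `rep(Q, Mod Λ)`. If `Λ` is a field these are the finite-dimensional ones
(for `Q` with finitely many vertices). -/
def repFg (Q : Type) [Quiver.{0} Q] (Λ : Type u) [Ring Λ] : ObjectProperty (QuiverRep Q Λ) :=
  fun M => ∀ i : Q, Module.Finite Λ (M.at_ i)

/-- The monomorphism category `mono(Q, Λ)`, as a full subcategory of `rep(Q, Mod Λ)`: the finitely
generated representations for which all the maps `h_{i,in}` are injective. -/
def monoCat (Q : Type) [Quiver.{0} Q] (Λ : Type u) [Ring Λ] : ObjectProperty (QuiverRep Q Λ) :=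
  fun M => repFg Q Λ M ∧ ∀ i : Q, Function.Injective (M.incoming i)

/-- An object `X` is indecomposable if it is nonzero, and if `X ≅ Y ⊕ Z` implies `Y = 0` or
`Z = 0`. Here `Y ⊕ Z` is any biproduct of `Y` and `Z`; it is not assumed that the category has all
biproducts. -/
def IsIndecomposable {C : Type*} [Category* C] [HasZeroMorphisms C] (X : C) : Prop :=
  ¬ IsZero X ∧
    ∀ (Y Z : C) (b : BinaryBicone Y Z), Nonempty b.IsBilimit → Nonempty (X ≅ b.pt) →
      IsZero Y ∨ IsZero Z

/-- An additive functor between full subcategories of abelian categories is exact if it sends the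
sequences `0 → X → Y → Z → 0` that are exact in the first ambient category to sequences that are
exact in the second. -/
def IsExactBetween {A B : Type*} [Category* A] [Category* B] [Abelian A] [Abelian B]
    {P : ObjectProperty A} {R : ObjectProperty B} (F : P.FullSubcategory ⥤ R.FullSubcategory)
    [F.Additive] : Prop :=
  ∀ S : ShortComplex P.FullSubcategory,
    (S.map P.ι).ShortExact → ((S.map F).map R.ι).ShortExact

/-- Wildness in the sense of Drozd, over a field `k`, of a full subcategory `R` of a `k`-linear
abelian category: there is a faithful exact (`k`-linear) functor to `R` from the category of
finite-dimensional representations of the quiver with one vertex and two loops that preserves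
indecomposables and reflects isomorphisms, i.e. sends non-isomorphic objects to non-isomorphic
ones. (That a morphism is invertible if its image is invertible follows from faithfulness.) -/
def IsWild (k : Type u) [Field k] {B : Type*} [Category* B] [Abelian B] [Linear k B]
    (R : ObjectProperty B) : Prop :=
  ∃ (F : (repFg TwoLoopQuiver k).FullSubcategory ⥤ R.FullSubcategory) (_ : F.Additive),
    F.Linear k ∧ F.Faithful ∧ IsExactBetween F ∧
      (∀ X, IsIndecomposable X → IsIndecomposable (F.obj X)) ∧
      (∀ X Y, Nonempty (F.obj X ≅ F.obj Y) → Nonempty (X ≅ Y))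

/-- The algebra `k[x]/(x^n)`. -/
abbrev TruncatedPolynomial (k : Type u) [Field k] (n : ℕ) : Type u :=
  k[X] ⧸ Ideal.span {(Polynomial.X ^ n : k[X])}

/-!
A pair of operators `A`, `B` on `V` is encoded in the representation `V² ⇉ V³ ← V` of the extended
Kronecker quiver with the arrows `(x, y) ↦ (x, y, A y)`, `(x, y) ↦ (0, x, y)` and
`v ↦ (v, 0, B v)`; the morphisms between two such representations are exactly the linear maps
`V → W` that commute with the operators, applied to each factor.

A representation `a, b : Z ⇉ T ← P : c` of this quiver is turned into a sequence of submodules of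
the graded module `M₄ = Z ⊕ Z² ⊕ Z² ⊕ T` on which `x` acts by `z ↦ (z, z)`, the identity of `Z²` and
`(y, z) ↦ a y + b z`: the submodule `M₃` consists of `Z × 0`, `Z²` and `T` in the last three
degrees, `M₂` of `0 × Z` and `T` in the last two, and `M₁` is the image of `P` in `T`. A morphism
between two such sequences need not be homogeneous, but it does not lower degrees, and its part of
degree zero is diagonal, given by a morphism of representations of the extended Kronecker quiver.
Restriction to `M₁` is thus a retraction of the functor on morphisms, and an endomorphism that
restricts to zero raises degrees, so that it is nilpotent.
-/

section Categories

variable {C D : Type*} [Category* C] [Category* D] [Preadditive C] [Preadditive D]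

lemma comp_eq_zero_of_complementary_splittings {X Y Z : C} {p : X ⟶ X} {i : Y ⟶ X} {r : X ⟶ Y}
    {j : Z ⟶ X} {s : X ⟶ Z} (hir : i ≫ r = 𝟙 Y) (hri : r ≫ i = p) (hjs : j ≫ s = 𝟙 Z)
    (hsj : s ≫ j = 𝟙 X - p) : i ≫ s = 0 := by
  have hisj : i ≫ s ≫ j = 0 := by
    rw [hsj, ← hri, Preadditive.comp_sub, Category.comp_id, reassoc_of% hir, sub_self]
  calc i ≫ s = (i ≫ s ≫ j) ≫ s := by simp only [Category.assoc, hjs, Category.comp_id]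
    _ = 0 := by rw [hisj, zero_comp]

lemma IsIndecomposable.eq_zero_or_eq_id [IsIdempotentComplete C] {X : C}
    (hX : IsIndecomposable X) {p : X ⟶ X} (hp : p ≫ p = p) : p = 0 ∨ p = 𝟙 X := by
  obtain ⟨Y, i, r, hir, hri⟩ := IsIdempotentComplete.idempotents_split X p hp
  obtain ⟨Z, j, s, hjs, hsj⟩ := IsIdempotentComplete.idempotents_split X (𝟙 X - p) (by simp [hp])
  let b : BinaryBicone Y Z :=
    { pt := X, fst := r, snd := s, inl := i, inr := j
      inl_fst := hir
      inl_snd := comp_eq_zero_of_complementary_splittings hir hri hjs hsj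
      inr_fst := comp_eq_zero_of_complementary_splittings hjs hsj hir (by rw [hri]; abel)
      inr_snd := hjs }
  have hb : b.IsBilimit := isBinaryBilimitOfTotal b (by
    change r ≫ i + s ≫ j = 𝟙 X
    rw [hri, hsj, add_sub_cancel])
  rcases hX.2 Y Z b ⟨hb⟩ ⟨Iso.refl X⟩ with hY | hZ
  · left
    rw [← hri, hY.eq_of_src i 0, comp_zero]
  · right
    rw [eq_comm, ← sub_eq_zero, ← hsj, hZ.eq_of_src j 0, comp_zero]

lemma isIndecomposable_of_idempotents {X : C} (hX : ¬ IsZero X)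
    (h : ∀ p : X ⟶ X, p ≫ p = p → p = 0 ∨ p = 𝟙 X) : IsIndecomposable X := by
  refine ⟨hX, fun Y Z b _ ⟨φ⟩ => ?_⟩
  rcases h (φ.hom ≫ (b.fst ≫ b.inl) ≫ φ.inv) (by simp) with h0 | h1
  · left
    rw [IsZero.iff_id_eq_zero]
    calc 𝟙 Y = b.inl ≫ φ.inv ≫ (φ.hom ≫ (b.fst ≫ b.inl) ≫ φ.inv) ≫ φ.hom ≫ b.fst := by simp
      _ = 0 := by simp only [h0, zero_comp, comp_zero]
  · right
    rw [IsZero.iff_id_eq_zero]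
    calc 𝟙 Z = b.inr ≫ φ.inv ≫ 𝟙 X ≫ φ.hom ≫ b.snd := by simp
      _ = b.inr ≫ φ.inv ≫ (φ.hom ≫ (b.fst ≫ b.inl) ≫ φ.inv) ≫ φ.hom ≫ b.snd := by rw [h1]
      _ = 0 := by simp

/-- A retraction of a functor `F` on morphisms: additive maps `Hom(F X, F Y) → Hom(X, Y)`,
compatible with composition, that are left inverse to the maps `f ↦ F f`. -/
structure HomRetraction (F : C ⥤ D) where
  retract {X Y : C} : (F.obj X ⟶ F.obj Y) →+ (X ⟶ Y)
  retract_map {X Y : C} (f : X ⟶ Y) : retract (F.map f) = f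
  retract_comp {X Y Z : C} (φ : F.obj X ⟶ F.obj Y) (ψ : F.obj Y ⟶ F.obj Z) :
    retract (φ ≫ ψ) = retract φ ≫ retract ψ

namespace HomRetraction

variable {F : C ⥤ D} (G : HomRetraction F)

lemma retract_id (X : C) : G.retract (𝟙 (F.obj X)) = 𝟙 X := by
  rw [← F.map_id, G.retract_map]

include G in
lemma faithful : F.Faithful where
  map_injective {_ _ f g} h := by rw [← G.retract_map f, h, G.retract_map]

/-- The isomorphism `X ≅ Y` obtained by retracting an isomorphism `F X ≅ F Y`. -/
def retractIso {X Y : C} (φ : F.obj X ≅ F.obj Y) : X ≅ Y where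
  hom := G.retract φ.hom
  inv := G.retract φ.inv
  hom_inv_id := by rw [← G.retract_comp, φ.hom_inv_id, G.retract_id]
  inv_hom_id := by rw [← G.retract_comp, φ.inv_hom_id, G.retract_id]

lemma isIndecomposable_obj [IsIdempotentComplete C] {X : C} (hX : IsIndecomposable X)
    (hG : ∀ p : F.obj X ⟶ F.obj X, p ≫ p = p → G.retract p = 0 → p = 0) :
    IsIndecomposable (F.obj X) := by
  refine isIndecomposable_of_idempotents (fun h => hX.1 ?_) fun p hp => ?_
  · rw [IsZero.iff_id_eq_zero, ← G.retract_id, h.eq_of_src (𝟙 _) 0, map_zero]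
  · rcases hX.eq_zero_or_eq_id (p := G.retract p) (by rw [← G.retract_comp, hp]) with h0 | h1
    · exact Or.inl (hG p hp h0)
    · refine Or.inr (sub_eq_zero.1 (hG (𝟙 _ - p) (by simp [hp]) ?_)).symm
      rw [map_sub, G.retract_id, h1, sub_self]

end HomRetraction

instance fullSubcategory_isIdempotentComplete (P : ObjectProperty C) [P.IsStableUnderRetracts]
    [IsIdempotentComplete C] : IsIdempotentComplete P.FullSubcategory where
  idempotents_split X p hp := by
    obtain ⟨Y, i, r, hir, hri⟩ :=
      IsIdempotentComplete.idempotents_split X.obj p.hom (congrArg InducedCategory.Hom.hom hp)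
    have hY : P Y := P.prop_of_retract ⟨i, r, hir⟩ X.property
    exact ⟨⟨Y, hY⟩, ObjectProperty.homMk i, ObjectProperty.homMk r,
      ObjectProperty.hom_ext _ hir, ObjectProperty.hom_ext _ hri⟩

lemma shortExact_iff_evaluation {J A : Type*} [Category* J] [Category* A] [Abelian A]
    (S : ShortComplex (J ⥤ A)) :
    S.ShortExact ↔ ∀ j, (S.map ((evaluation J A).obj j)).ShortExact :=
  have : JointlyReflectIsomorphisms (evaluation J A).obj :=
    ⟨fun f h => NatTrans.isIso_iff_isIso_app f |>.2 h⟩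
  this.shortExact_iff S

end Categories

section TruncatedPolynomialModules

variable {k : Type u} [Field k] {n : ℕ} {E E' : Type u} [AddCommGroup E] [Module k E]
  [AddCommGroup E'] [Module k E']

/-- The space `E` as a module over `k[x]/(x^n)`, where `x` acts by an operator `T` with
`T ^ n = 0`. -/
def TruncatedAEval (T : Module.End k E) (_ : T ^ n = 0) : Type u := Module.AEval' T

namespace TruncatedAEval

variable {T : Module.End k E} {T' : Module.End k E'} {hT : T ^ n = 0} {hT' : T' ^ n = 0}

instance : AddCommGroup (TruncatedAEval T hT) := inferInstanceAs (AddCommGroup (Module.AEval' T))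

instance : Module k (TruncatedAEval T hT) := inferInstanceAs (Module k (Module.AEval' T))

noncomputable instance : Module k[X] (TruncatedAEval T hT) :=
  inferInstanceAs (Module k[X] (Module.AEval' T))

instance : IsScalarTower k k[X] (TruncatedAEval T hT) :=
  inferInstanceAs (IsScalarTower k k[X] (Module.AEval' T))

lemma isTorsionBySet :
    Module.IsTorsionBySet k[X] (TruncatedAEval T hT) (Ideal.span {(Polynomial.X ^ n : k[X])}) := by
  rw [Module.isTorsionBySet_span_singleton_iff]
  refine (Module.AEval'.of T).surjective.forall.2 fun m => ?_
  exact (Module.AEval'.X_pow_smul_of T m n).trans (by rw [hT]; exact map_zero (Module.AEval'.of T))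

noncomputable instance : Module (TruncatedPolynomial k n) (TruncatedAEval T hT) :=
  isTorsionBySet.module

instance : IsScalarTower k[X] (TruncatedPolynomial k n) (TruncatedAEval T hT) :=
  isTorsionBySet.isScalarTower

instance : IsScalarTower k (TruncatedPolynomial k n) (TruncatedAEval T hT) :=
  isTorsionBySet.isScalarTower

/-- The identification of `E` with the module `TruncatedAEval T hT` as vector spaces. -/
noncomputable def of (T : Module.End k E) (hT : T ^ n = 0) : E ≃ₗ[k] TruncatedAEval T hT :=
  Module.AEval'.of T

/-- `TruncatedAEval T hT` as an object of the category of modules over `k[x]/(x^n)`. -/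
noncomputable def toModuleCat (T : Module.End k E) (hT : T ^ n = 0) :
    ModuleCat.{u} (TruncatedPolynomial k n) :=
  ModuleCat.of _ (TruncatedAEval T hT)

instance [Module.Finite k E] : Module.Finite (TruncatedPolynomial k n) (toModuleCat T hT) :=
  have : Module.Finite k (TruncatedAEval T hT) :=
    inferInstanceAs (Module.Finite k (Module.AEval' T))
  Module.Finite.of_restrictScalars_finite k (TruncatedPolynomial k n) (TruncatedAEval T hT)

/-- A linear map that intertwines two nilpotent operators, as a morphism of modules over
`k[x]/(x^n)`. -/
noncomputable def homOfIntertwining (f : E →ₗ[k] E') (hf : ∀ v, f (T v) = T' (f v)) :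
    toModuleCat T hT ⟶ toModuleCat T' hT' :=
  have h : Function.Surjective (algebraMap k[X] (TruncatedPolynomial k n)) :=
    Ideal.Quotient.mk_surjective
  let g : TruncatedAEval T hT →ₗ[k[X]] TruncatedAEval T' hT' :=
    LinearMap.ofAEval (M := E) T ((of T' hT').toLinearMap ∘ₗ f) fun v =>
      (congrArg (of T' hT') (hf v)).trans (Module.AEval'.X_smul_of T' (f v)).symm
  ModuleCat.ofHom (g.extendScalarsOfSurjective h)

/-- The underlying linear map of a morphism of modules over `k[x]/(x^n)`. -/
noncomputable def toLinearMap (g : toModuleCat T hT ⟶ toModuleCat T' hT') : E →ₗ[k] E' :=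
  let g' : TruncatedAEval T hT →ₗ[TruncatedPolynomial k n] TruncatedAEval T' hT' := g.hom
  (of T' hT').symm.toLinearMap ∘ₗ g'.restrictScalars k ∘ₗ (of T hT).toLinearMap

lemma toLinearMap_injective : Function.Injective (toLinearMap (hT := hT) (hT' := hT')) :=
  fun _ _ h => ModuleCat.hom_ext (LinearMap.ext fun v => LinearMap.congr_fun h v)

lemma toLinearMap_smul (c : k) (g : toModuleCat T hT ⟶ toModuleCat T' hT') :
    toLinearMap (c • g) = c • toLinearMap g :=
  LinearMap.ext fun v => congrArg (of T' hT').symm <|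
    algebraMap_smul (M := TruncatedAEval T' hT') (TruncatedPolynomial k n) c (g.hom (of T hT v))

lemma toLinearMap_intertwines (g : toModuleCat T hT ⟶ toModuleCat T' hT') (v : E) :
    toLinearMap g (T v) = T' (toLinearMap g v) := by
  let g' : TruncatedAEval T hT →ₗ[TruncatedPolynomial k n] TruncatedAEval T' hT' := g.hom
  have h := (g'.restrictScalars k[X]).map_smul Polynomial.X (of T hT v)
  have e : (Polynomial.X : k[X]) • of T hT v = of T hT (T v) := Module.AEval'.X_smul_of T v
  rw [e] at h
  exact (congrArg (of T' hT').symm h).trans (Module.AEval'.of_symm_X_smul T' _)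

end TruncatedAEval

end TruncatedPolynomialModules

section Sequences

variable {C : Type*} [Category* C] {X : ℕ → C} (f : ∀ n, X n ⟶ X (n + 1))

/-- The composite `X i ⟶ X j` of consecutive terms of a sequence of morphisms. -/
def transition {i j : ℕ} (hij : i ≤ j) : X i ⟶ X j :=
  (Functor.ofSequence f).map (homOfLE hij)

lemma transition_self (i : ℕ) : transition f (le_refl i) = 𝟙 (X i) :=
  (Functor.ofSequence f).map_id i

lemma transition_self_succ (i : ℕ) : transition f i.le_succ = f i :=
  Functor.ofSequence_map_homOfLE_succ f i

lemma transition_succ {i j : ℕ} (hij : i ≤ j) :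
    transition f (hij.trans j.le_succ) = transition f hij ≫ f j := by
  rw [← transition_self_succ f j]
  exact (Functor.ofSequence f).map_comp (homOfLE hij) (homOfLE j.le_succ)

lemma transition_mem (W : MorphismProperty C) [W.IsMultiplicative] {i j : ℕ} (hij : i ≤ j)
    (hf : ∀ n, i ≤ n → W (f n)) : W (transition f hij) := by
  induction j, hij using Nat.le_induction with
  | base =>
    rw [transition_self]
    exact W.id_mem (X i)
  | succ j hij ih =>
    rw [transition_succ f hij]
    exact W.comp_mem _ _ ih (hf j hij)

end Sequences

namespace LinearQuiver

/-- The functor from the path category of `1 → 2 → ⋯ → m` to the ordered set `ℕ` that numbers the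
vertices from `0` on. -/
def pathsToNat (m : ℕ) : Paths (LinearQuiver m) ⥤ ℕ :=
  Paths.lift { obj i := Fin.val (n := m) i, map α := homOfLE (by have := α.down; lia) }

lemma nonempty_path {m i j : ℕ} (hij : i ≤ j) (hj : j < m) :
    Nonempty ((Paths.of (LinearQuiver m)).obj (⟨i, by lia⟩ : Fin m) ⟶
      (Paths.of (LinearQuiver m)).obj (⟨j, hj⟩ : Fin m)) := by
  induction j, hij using Nat.le_induction with
  | base => exact ⟨𝟙 _⟩
  | succ j hij ih =>
    obtain ⟨p⟩ := ih (by lia)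
    exact ⟨Quiver.Path.cons p ⟨rfl⟩⟩

variable {Λ : Type u} [Ring Λ] {m : ℕ}

open Classical in
lemma incoming_injective {M : QuiverRep (LinearQuiver m) Λ}
    (h : ∀ (i j : LinearQuiver m) (α : i ⟶ j), Function.Injective (M.along α))
    (j : LinearQuiver m) : Function.Injective (M.incoming j) := by
  have : Subsingleton (Σ i : LinearQuiver m, (i ⟶ j)) := by
    constructor
    rintro ⟨i, ⟨hi⟩⟩ ⟨i', ⟨hi'⟩⟩
    obtain rfl : i = i' := Fin.ext (by lia)
    rfl
  rw [injective_iff_map_eq_zero]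
  intro x hx
  ext α
  have hxα : x = DirectSum.lof Λ _ (fun α : (Σ i, (i ⟶ j)) => M.at_ α.1) α (x α) := by
    ext β
    obtain rfl := Subsingleton.elim α β
    simp [DirectSum.lof_apply]
  rw [hxα, QuiverRep.incoming, DirectSum.toModule_lof] at hx
  exact h _ _ α.2 (hx.trans (map_zero (M.along α.2)).symm)

/-- The representation of `1 → 2 → ⋯ → m` given by the first `m` terms of a sequence of modules. -/
def sequenceRep (m : ℕ) {X : ℕ → ModuleCat.{u} Λ} (f : ∀ n, X n ⟶ X (n + 1)) :
    QuiverRep (LinearQuiver m) Λ :=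
  pathsToNat m ⋙ Functor.ofSequence f

namespace sequenceRep

variable {X Y : ℕ → ModuleCat.{u} Λ} {f : ∀ n, X n ⟶ X (n + 1)} {g : ∀ n, Y n ⟶ Y (n + 1)}

lemma monoCat_of_injective (hX : ∀ n, Module.Finite Λ (X n))
    (hf : ∀ n, Function.Injective (f n).hom) :
    monoCat (LinearQuiver m) Λ (sequenceRep m f) := by
  refine ⟨fun i => hX _, incoming_injective fun i j α => ?_⟩
  have hij : Fin.val (n := m) i ≤ Fin.val (n := m) j := by have := α.down; lia
  have : Mono (transition f hij) := transition_mem f (.monomorphisms _) hij fun n _ =>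
    (ModuleCat.mono_iff_injective _).2 (hf n)
  exact (ModuleCat.mono_iff_injective _).1 this

/-- The morphism of representations given by a morphism of sequences. -/
def map (φ : ∀ n, X n ⟶ Y n) (hφ : ∀ n, f n ≫ φ (n + 1) = φ n ≫ g n) :
    sequenceRep m f ⟶ sequenceRep m g :=
  Functor.whiskerLeft _ (NatTrans.ofSequence φ fun n => by
    simpa only [Functor.ofSequence_map_homOfLE_succ] using! hφ n)

/-- The component of a morphism of representations at the vertex with number `i`. -/
def component (φ : sequenceRep m f ⟶ sequenceRep m g) (i : ℕ) (hi : i < m) : X i ⟶ Y i :=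
  φ.app ((Paths.of _).obj (⟨i, hi⟩ : Fin m))

lemma component_naturality (φ : sequenceRep m f ⟶ sequenceRep m g) {i j : ℕ} (hij : i ≤ j)
    (hj : j < m) :
    transition f hij ≫ component φ j hj = component φ i (by lia) ≫ transition g hij :=
  φ.naturality (nonempty_path hij hj).some

lemma component_succ (φ : sequenceRep m f ⟶ sequenceRep m g) (i : ℕ) (hi : i + 1 < m) :
    f i ≫ component φ (i + 1) hi = component φ i (by lia) ≫ g i := by
  simpa only [transition_self_succ] using component_naturality φ i.le_succ hi

lemma hom_ext_of_component {φ ψ : sequenceRep m f ⟶ sequenceRep m g} {i : ℕ} (hi : i < m)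
    (hg : ∀ n, Mono (g n)) (hf : ∀ n, i ≤ n → Epi (f n))
    (h : component φ i hi = component ψ i hi) : φ = ψ := by
  suffices ∀ j (hj : j < m), component φ j hj = component ψ j hj from
    NatTrans.ext (funext fun j => this _ (Fin.isLt (n := m) j))
  intro j hj
  rcases le_total i j with hij | hji
  · have : Epi (transition f hij) := transition_mem f (.epimorphisms _) hij hf
    rw [← cancel_epi (transition f hij), component_naturality, h, component_naturality]
  · have : Mono (transition g hji) := transition_mem g (.monomorphisms _) hji fun n _ => hg n
    rw [← cancel_mono (transition g hji), ← component_naturality _ hji hi, h,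
      component_naturality]

end sequenceRep

end LinearQuiver

instance repFg_isStableUnderRetracts {Q : Type} [Quiver.{0} Q] {Λ : Type u} [Ring Λ] :
    (repFg Q Λ).IsStableUnderRetracts where
  of_retract {X Y} r hY i := by
    have := hY i
    refine Module.Finite.of_surjective (r.r.app ((Paths.of Q).obj i)).hom fun x =>
      ⟨(r.i.app ((Paths.of Q).obj i)).hom x, ?_⟩
    exact LinearMap.congr_fun
      (congrArg ModuleCat.Hom.hom (NatTrans.congr_app r.retract ((Paths.of Q).obj i))) x

namespace TwoLoopQuiver

variable {k : Type u} [Field k]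

/-- The vector space of a representation of the quiver with two loops. -/
abbrev space (X : QuiverRep TwoLoopQuiver k) : Type u := X.at_ (Quiver.SingleObj.star (Fin 2))

/-- The operators of a representation of the quiver with two loops. -/
abbrev loop (X : QuiverRep TwoLoopQuiver k) (i : Fin 2) : space X →ₗ[k] space X :=
  X.along (Quiver.SingleObj.toHom i)

/-- The linear map of vector spaces given by a morphism of representations. -/
abbrev spaceMap {X Y : QuiverRep TwoLoopQuiver k} (h : X ⟶ Y) : space X →ₗ[k] space Y :=
  (h.app ((Paths.of TwoLoopQuiver).obj (Quiver.SingleObj.star (Fin 2)))).hom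

lemma spaceMap_loop {X Y : QuiverRep TwoLoopQuiver k} (h : X ⟶ Y) (i : Fin 2) :
    spaceMap h ∘ₗ loop X i = loop Y i ∘ₗ spaceMap h :=
  congrArg ModuleCat.Hom.hom
    (h.naturality ((Paths.of TwoLoopQuiver).map (Quiver.SingleObj.toHom i)))

/-- The morphism of representations given by a linear map that commutes with the operators. -/
def homOfSpaceMap {X Y : QuiverRep TwoLoopQuiver k} (p : space X →ₗ[k] space Y)
    (hp : ∀ i, p ∘ₗ loop X i = loop Y i ∘ₗ p) : X ⟶ Y where
  app _ := ModuleCat.ofHom p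
  naturality _ _ f := by
    induction f using Paths.induction with
    | id =>
      rw [X.map_id, Y.map_id]
      rfl
    | comp q i hq =>
      have hi : X.map ((Paths.of TwoLoopQuiver).map i) ≫ ModuleCat.ofHom p =
          ModuleCat.ofHom p ≫ Y.map ((Paths.of TwoLoopQuiver).map i) := ModuleCat.hom_ext (hp i)
      rw [X.map_comp, Y.map_comp, Category.assoc, ← reassoc_of% hq]
      exact congrArg (X.map q ≫ ·) hi

end TwoLoopQuiver

section ExtendedKroneckerRepresentations

variable {R Z T P Z' T' P' : Type*} [Ring R]
  [AddCommGroup Z] [Module R Z] [AddCommGroup T] [Module R T] [AddCommGroup P] [Module R P]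
  [AddCommGroup Z'] [Module R Z'] [AddCommGroup T'] [Module R T'] [AddCommGroup P'] [Module R P']

variable (R Z T P) in
/-- A representation `Z ⇉ T ← P` of the extended Kronecker quiver in which the arrow `c : P → T` and
the sum of the two arrows `a, b : Z → T` are injective and `a` and `b` are jointly surjective. -/
structure ExtendedKronecker where
  a : Z →ₗ[R] T
  b : Z →ₗ[R] T
  c : P →ₗ[R] T
  injective_add : Function.Injective (a + b)
  surjective_coprod : Function.Surjective (a.coprod b)
  injective_c : Function.Injective c

namespace ExtendedKronecker

/-- A morphism of representations, given by its components at `Z`, `T` and `P`. -/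
structure IsHom (K : ExtendedKronecker R Z T P) (K' : ExtendedKronecker R Z' T' P')
    (γ : Z →ₗ[R] Z') (τ : T →ₗ[R] T') (π : P →ₗ[R] P') : Prop where
  map_a (z : Z) : τ (K.a z) = K'.a (γ z)
  map_b (z : Z) : τ (K.b z) = K'.b (γ z)
  map_c (p : P) : τ (K.c p) = K'.c (π p)

section Stages

variable (K : ExtendedKronecker R Z T P)

/-- The action of `x` on the second module of the sequence of submodules defined by `K`, the first
one being `P` with the zero action. -/
def shift₂ : Module.End R (Z × T) where
  toFun v := (0, K.b v.1)
  map_add' _ _ := by simp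
  map_smul' _ _ := by simp

/-- The action of `x` on the third module of the sequence defined by `K`. -/
def shift₃ : Module.End R (Z × (Z × Z) × T) where
  toFun v := (0, (v.1, 0), K.a.coprod K.b v.2.1)
  map_add' _ _ := by simp [add_add_add_comm]
  map_smul' _ _ := by simp

/-- The action of `x` on the fourth module of the sequence defined by `K`. -/
def shift₄ : Module.End R (Z × (Z × Z) × (Z × Z) × T) where
  toFun v := (0, (v.1, v.1), v.2.1, K.a.coprod K.b v.2.2.1)
  map_add' _ _ := by simp [add_add_add_comm]
  map_smul' _ _ := by simp

/-- The inclusion of the first module of the sequence defined by `K` into the second. -/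
def incl₁ : P →ₗ[R] Z × T := .inr R Z T ∘ₗ K.c

variable (R Z T) in
/-- The inclusion of the second module of the sequence defined by `K` into the third. -/
def incl₂ : Z × T →ₗ[R] Z × (Z × Z) × T :=
  .inr R Z ((Z × Z) × T) ∘ₗ (LinearMap.inr R Z Z).prodMap .id

variable (R Z T) in
/-- The inclusion of the third module of the sequence defined by `K` into the fourth. -/
def incl₃ : Z × (Z × Z) × T →ₗ[R] Z × (Z × Z) × (Z × Z) × T :=
  .inr R Z ((Z × Z) × (Z × Z) × T) ∘ₗ (LinearMap.inl R Z Z).prodMap .id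

lemma incl₁_injective : Function.Injective K.incl₁ :=
  LinearMap.inr_injective.comp K.injective_c

lemma incl₂_injective : Function.Injective (incl₂ R Z T) :=
  LinearMap.inr_injective.comp (LinearMap.inr_injective.prodMap Function.injective_id)

lemma incl₃_injective : Function.Injective (incl₃ R Z T) :=
  LinearMap.inr_injective.comp (LinearMap.inl_injective.prodMap Function.injective_id)

lemma incl₁_zero (p : P) : K.incl₁ ((0 : Module.End R P) p) = K.shift₂ (K.incl₁ p) := by
  simp [incl₁, shift₂]

lemma incl₂_shift (v : Z × T) : incl₂ R Z T (K.shift₂ v) = K.shift₃ (incl₂ R Z T v) := by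
  simp [incl₂, shift₂, shift₃]

lemma incl₃_shift (v : Z × (Z × Z) × T) :
    incl₃ R Z T (K.shift₃ v) = K.shift₄ (incl₃ R Z T v) := by
  simp [incl₃, shift₃, shift₄]

variable {n : ℕ}

lemma shift₂_pow (hn : 4 ≤ n) : K.shift₂ ^ n = 0 :=
  pow_eq_zero_of_le (by lia : 2 ≤ n) (by ext <;> simp [shift₂, pow_two])

lemma shift₃_pow (hn : 4 ≤ n) : K.shift₃ ^ n = 0 :=
  pow_eq_zero_of_le (by lia : 3 ≤ n) (by ext <;> simp [shift₃, pow_succ])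

lemma shift₄_pow (hn : 4 ≤ n) : K.shift₄ ^ n = 0 :=
  pow_eq_zero_of_le hn (by ext <;> simp [shift₄, pow_succ])

end Stages

variable {K : ExtendedKronecker R Z T P} {K' : ExtendedKronecker R Z' T' P'}

variable (K K') in
/-- A morphism between the sequences of modules defined by `K` and `K'`: linear maps compatible with
the actions of `x` on the last modules, and thus with all the others, and with the inclusions. -/
structure IsChainMap (f₁ : P →ₗ[R] P') (f₂ : Z × T →ₗ[R] Z' × T')
    (f₃ : Z × (Z × Z) × T →ₗ[R] Z' × (Z' × Z') × T')
    (f₄ : Z × (Z × Z) × (Z × Z) × T →ₗ[R] Z' × (Z' × Z') × (Z' × Z') × T') : Prop where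
  map_shift v : f₄ (K.shift₄ v) = K'.shift₄ (f₄ v)
  map_incl₁ v : f₂ (K.incl₁ v) = K'.incl₁ (f₁ v)
  map_incl₂ v : f₃ (incl₂ R Z T v) = incl₂ R Z' T' (f₂ v)
  map_incl₃ v : f₄ (incl₃ R Z T v) = incl₃ R Z' T' (f₃ v)

namespace IsChainMap

variable {f₁ : P →ₗ[R] P'} {f₂ : Z × T →ₗ[R] Z' × T'}
    {f₃ : Z × (Z × Z) × T →ₗ[R] Z' × (Z' × Z') × T'}
    {f₄ : Z × (Z × Z) × (Z × Z) × T →ₗ[R] Z' × (Z' × Z') × (Z' × Z') × T'}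

/-- The map between the spaces `Z` that a morphism induces on the quotients of the third modules. -/
def base (_ : K.IsChainMap K' f₁ f₂ f₃ f₄) : Z →ₗ[R] Z' :=
  .fst R Z' _ ∘ₗ f₃ ∘ₗ .inl R Z _

/-- The map that a morphism induces on the components `T` of the fourth modules. -/
def top (_ : K.IsChainMap K' f₁ f₂ f₃ f₄) : T →ₗ[R] T' :=
  .snd R _ T' ∘ₗ .snd R _ _ ∘ₗ .snd R Z' _ ∘ₗ f₄ ∘ₗ
    .inr R Z _ ∘ₗ .inr R (Z × Z) _ ∘ₗ .inr R (Z × Z) T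

variable (h : K.IsChainMap K' f₁ f₂ f₃ f₄)
include h

lemma map_degree_one (w : Z × Z) : f₄ (0, 0, w, 0) = K'.shift₄ (f₄ (0, w, 0, 0)) := by
  rw [← h.map_shift]
  simp [shift₄, Prod.mk_zero_zero]

lemma map_degree_two (w : Z × Z) :
    f₄ (0, 0, 0, K.a.coprod K.b w) = K'.shift₄ (K'.shift₄ (f₄ (0, w, 0, 0))) := by
  rw [← h.map_degree_one, ← h.map_shift]
  simp [shift₄, Prod.mk_zero_zero]

lemma map_diagonal (z : Z) : f₄ (0, (z, z), 0, 0) = K'.shift₄ (f₄ (z, 0, 0, 0)) := by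
  rw [← h.map_shift]
  simp [shift₄]

/-- Since `x ^ 3` acts on the component `Z` through the injective map `a + b`, the submodule it
annihilates is preserved. -/
lemma map_middle_fst (w : Z × Z) : (f₄ (0, w, 0, 0)).1 = 0 := by
  have hw : K'.shift₄ (K'.shift₄ (K'.shift₄ (f₄ (0, w, 0, 0)))) = 0 := by
    simp only [← h.map_shift]
    simp [shift₄, Prod.mk_zero_zero]
  apply K'.injective_add
  simpa [shift₄, Prod.mk_zero_zero] using hw

lemma map_left (z : Z) : (f₄ (0, (z, 0), 0, 0)).2.1 = (h.base z, 0) :=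
  congrArg (fun v => v.2.1) (h.map_incl₃ (z, 0, 0))

lemma map_right_fst (z : Z) : (f₄ (0, (0, z), 0, 0)).2.1.1 = 0 := by
  have := congrArg (fun v => v.2.2.1.1) (h.map_incl₃ (incl₂ R Z T (z, 0)))
  rw [h.map_incl₂] at this
  simpa [incl₃, incl₂, Prod.mk_zero_zero, h.map_degree_one, shift₄] using this

lemma map_diagonal_right (z : Z) : (f₄ (0, (z, z), 0, 0)).2.1 = (h.base z, h.base z) := by
  have hz : f₄ (0, (z, z), 0, 0) = f₄ (0, (z, 0), 0, 0) + f₄ (0, (0, z), 0, 0) := by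
    simp [← map_add]
  have hfst : (f₄ (0, (z, z), 0, 0)).2.1.1 = h.base z := by
    simp [hz, h.map_left, h.map_right_fst]
  rw [h.map_diagonal] at hfst ⊢
  exact Prod.ext hfst hfst

lemma map_middle (w : Z × Z) : (f₄ (0, w, 0, 0)).2.1 = h.base.prodMap h.base w := by
  have hw : f₄ (0, w, 0, 0) = f₄ (0, (w.1 - w.2, 0), 0, 0) + f₄ (0, (w.2, w.2), 0, 0) := by
    simp [← map_add]
  simp [hw, h.map_left, h.map_diagonal_right]

lemma map_last_coprod (w : Z × Z) :
    f₄ (0, 0, 0, K.a.coprod K.b w) = (0, 0, 0, K'.a.coprod K'.b (h.base.prodMap h.base w)) := by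
  rw [h.map_degree_two, ← h.map_middle]
  have := h.map_middle_fst w
  generalize f₄ (0, w, 0, 0) = v at this ⊢
  simp [shift₄, this, Prod.mk_zero_zero]

lemma map_last (t : T) : f₄ (0, 0, 0, t) = (0, 0, 0, h.top t) := by
  obtain ⟨w, rfl⟩ := K.surjective_coprod t
  have : h.top (K.a.coprod K.b w) = (f₄ (0, 0, 0, K.a.coprod K.b w)).2.2.2 := rfl
  rw [this, h.map_last_coprod]

lemma top_coprod (w : Z × Z) :
    h.top (K.a.coprod K.b w) = K'.a.coprod K'.b (h.base.prodMap h.base w) := by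
  simpa using (h.map_last _).symm.trans (h.map_last_coprod w)

lemma isHom : K.IsHom K' h.base h.top f₁ where
  map_a z := by simpa using h.top_coprod (z, 0)
  map_b z := by simpa using h.top_coprod (0, z)
  map_c p := by
    have := h.map_incl₃ (incl₂ R Z T (K.incl₁ p))
    rw [h.map_incl₂, h.map_incl₁] at this
    simpa [incl₁, incl₂, incl₃, Prod.mk_zero_zero, h.map_last] using this

lemma map_fst (z : Z) : (f₄ (z, 0, 0, 0)).1 = h.base z := by
  have := h.map_diagonal_right z
  rw [h.map_diagonal] at this
  exact congrArg Prod.fst this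

end IsChainMap

lemma IsChainMap.eq_zero_of_base_eq_zero
    {f₁ : P →ₗ[R] P} {f₂ : Z × T →ₗ[R] Z × T} {f₃ : Z × (Z × Z) × T →ₗ[R] Z × (Z × Z) × T}
    {f₄ : Module.End R (Z × (Z × Z) × (Z × Z) × T)} (h : K.IsChainMap K f₁ f₂ f₃ f₄)
    (hf₄ : IsIdempotentElem f₄) (h0 : h.base = 0) : f₄ = 0 := by
  suffices ∀ v, f₄ v = v → v = 0 from
    LinearMap.ext fun v => this (f₄ v) (LinearMap.congr_fun hf₄ v)
  have htop : h.top = 0 := by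
    refine LinearMap.ext (K.surjective_coprod.forall.2 fun w => ?_)
    rw [h.top_coprod, h0, LinearMap.prodMap_zero, LinearMap.zero_apply, map_zero,
      LinearMap.zero_apply]
  rintro ⟨z, w, w', t⟩ hv
  have hsum : (z, w, w', t) =
      f₄ (z, 0, 0, 0) + f₄ (0, w, 0, 0) + f₄ (0, 0, w', 0) + f₄ (0, 0, 0, t) := by
    rw [← hv]
    simp [← map_add]
  rw [h.map_degree_one, h.map_last, htop] at hsum
  have h00 : f₄ (0, 0, 0, 0) = 0 := map_zero f₄
  obtain rfl : z = 0 := by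
    simpa [h.map_fst, h.map_middle_fst, shift₄, h0]
      using congrArg (fun v => v.1) hsum
  rw [h00, zero_add] at hsum
  obtain rfl : w = 0 := by
    simpa [h.map_middle, h.map_middle_fst, shift₄, h0]
      using! congrArg (fun v => v.2.1) hsum
  rw [h00, zero_add] at hsum
  obtain rfl : w' = 0 := by
    simpa [h.map_middle, shift₄, h0] using! congrArg (fun v => v.2.2.1) hsum
  simpa [shift₄, Prod.mk_zero_zero] using hsum

section DiagonalMaps

variable (γ : Z →ₗ[R] Z') (τ : T →ₗ[R] T')

/-- The diagonal map between the third modules with components `γ` and `τ`. -/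
abbrev diag₃ : Z × (Z × Z) × T →ₗ[R] Z' × (Z' × Z') × T' :=
  γ.prodMap ((γ.prodMap γ).prodMap τ)

/-- The diagonal map between the fourth modules with components `γ` and `τ`. -/
abbrev diag₄ : Z × (Z × Z) × (Z × Z) × T →ₗ[R] Z' × (Z' × Z') × (Z' × Z') × T' :=
  γ.prodMap ((γ.prodMap γ).prodMap ((γ.prodMap γ).prodMap τ))

variable {γ τ} {π : P →ₗ[R] P'}

namespace IsHom

variable (h : K.IsHom K' γ τ π)
include h

lemma diag₂_shift (v : Z × T) : γ.prodMap τ (K.shift₂ v) = K'.shift₂ (γ.prodMap τ v) := by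
  simp [shift₂, h.map_b]

lemma diag₃_shift (v : Z × (Z × Z) × T) : diag₃ γ τ (K.shift₃ v) = K'.shift₃ (diag₃ γ τ v) := by
  simp [shift₃, h.map_a, h.map_b]

lemma isChainMap : K.IsChainMap K' π (γ.prodMap τ) (diag₃ γ τ) (diag₄ γ τ) where
  map_shift v := by simp [shift₄, h.map_a, h.map_b]
  map_incl₁ v := by simp [incl₁, h.map_c]
  map_incl₂ v := by simp [incl₂]
  map_incl₃ v := by simp [incl₃]

end IsHom

end DiagonalMaps

end ExtendedKronecker

end ExtendedKroneckerRepresentations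

section ShortExactMaps

/-- The exactness of a sequence `0 → M → N → L → 0`, as a property of its two maps alone. -/
structure IsShortExact {M N L : Type*} [Zero L] (f : M → N) (g : N → L) : Prop where
  injective : Function.Injective f
  exact : Function.Exact f g
  surjective : Function.Surjective g

lemma IsShortExact.prodMap {M N L M' N' L' : Type*} [Zero L] [Zero L'] {f : M → N} {g : N → L}
    {f' : M' → N'} {g' : N' → L'} (h : IsShortExact f g) (h' : IsShortExact f' g') :
    IsShortExact (Prod.map f f') (Prod.map g g') where
  injective := h.injective.prodMap h'.injective
  exact y := by
    rw [Set.range_prodMap, Set.mem_prod, ← h.exact y.1, ← h'.exact y.2]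
    exact Prod.ext_iff
  surjective := h.surjective.prodMap h'.surjective

lemma shortExact_moduleCat_iff {R : Type u} [Ring R] (S : ShortComplex (ModuleCat.{u} R)) :
    S.ShortExact ↔ IsShortExact S.f.hom S.g.hom :=
  ⟨fun h => ⟨h.moduleCat_injective_f,
    (ShortComplex.ShortExact.moduleCat_exact_iff_function_exact S).1 h.exact,
    h.moduleCat_surjective_g⟩,
    fun h => ModuleCat.shortComplex_shortExact S h.exact h.injective h.surjective⟩

end ShortExactMaps

section ModuleSequences

variable {k : Type u} [Field k] {Z T P Z' T' P' : Type u}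
  [AddCommGroup Z] [Module k Z] [AddCommGroup T] [Module k T] [AddCommGroup P] [Module k P]
  [AddCommGroup Z'] [Module k Z'] [AddCommGroup T'] [Module k T'] [AddCommGroup P'] [Module k P']
  {K : ExtendedKronecker k Z T P} {K' : ExtendedKronecker k Z' T' P'} {m n : ℕ}

namespace ExtendedKronecker

open LinearQuiver TruncatedAEval sequenceRep

variable (K) in
/-- The sequence of modules over `k[x]/(x^n)` defined by `K`; it is constant from the fourth module
on. -/
noncomputable def stage (hn : 4 ≤ n) : ℕ → ModuleCat.{u} (TruncatedPolynomial k n)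
  | 0 => toModuleCat (0 : Module.End k P) (zero_pow (by lia))
  | 1 => toModuleCat K.shift₂ (K.shift₂_pow hn)
  | 2 => toModuleCat K.shift₃ (K.shift₃_pow hn)
  | _ + 3 => toModuleCat K.shift₄ (K.shift₄_pow hn)

variable (K) in
/-- The inclusions between consecutive modules of the sequence defined by `K`. -/
noncomputable def inclusion (hn : 4 ≤ n) : ∀ i, K.stage hn i ⟶ K.stage hn (i + 1)
  | 0 => homOfIntertwining K.incl₁ K.incl₁_zero
  | 1 => homOfIntertwining (incl₂ k Z T) K.incl₂_shift
  | 2 => homOfIntertwining (incl₃ k Z T) K.incl₃_shift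
  | _ + 3 => 𝟙 _

variable (K) (m) in
/-- The representation of `1 → 2 → ⋯ → m` by modules over `k[x]/(x^n)` defined by `K`. -/
noncomputable def rep (hn : 4 ≤ n) : QuiverRep (LinearQuiver m) (TruncatedPolynomial k n) :=
  sequenceRep m (K.inclusion hn)

lemma inclusion_injective (hn : 4 ≤ n) (i : ℕ) : Function.Injective (K.inclusion hn i).hom :=
  match i with
  | 0 => K.incl₁_injective
  | 1 => incl₂_injective
  | 2 => incl₃_injective
  | _ + 3 => Function.injective_id

lemma rep_mem_monoCat [Module.Finite k Z] [Module.Finite k T] [Module.Finite k P] (hn : 4 ≤ n) :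
    monoCat (LinearQuiver m) (TruncatedPolynomial k n) (K.rep m hn) := by
  refine monoCat_of_injective (fun i => ?_) (inclusion_injective hn)
  match i with
  | 0 | 1 | 2 | _ + 3 => unfold stage; infer_instance

/-- The linear map between the first modules underlying a morphism. -/
noncomputable def firstMap {hn : 4 ≤ n} (hm : 4 ≤ m) (φ : K.rep m hn ⟶ K'.rep m hn) :
    P →ₗ[k] P' :=
  toLinearMap (component φ 0 (by lia))

/-- The linear map between the fourth modules underlying a morphism. -/
noncomputable def fourthMap {hn : 4 ≤ n} (hm : 4 ≤ m) (φ : K.rep m hn ⟶ K'.rep m hn) :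
    Z × (Z × Z) × (Z × Z) × T →ₗ[k] Z' × (Z' × Z') × (Z' × Z') × T' :=
  toLinearMap (component φ 3 (by lia))

lemma fourthMap_injective {hn : 4 ≤ n} (hm : 4 ≤ m) :
    Function.Injective (fourthMap (K := K) (K' := K') (hn := hn) hm) := by
  refine fun φ ψ h => hom_ext_of_component (by lia : 3 < m)
    (fun i => (ModuleCat.mono_iff_injective _).2 (inclusion_injective hn i)) (fun i hi => ?_)
    (toLinearMap_injective h)
  obtain ⟨j, rfl⟩ := Nat.exists_eq_add_of_le' hi
  exact inferInstanceAs (Epi (𝟙 _))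

lemma fourthMap_smul {hn : 4 ≤ n} (hm : 4 ≤ m) (c : k) (φ : K.rep m hn ⟶ K'.rep m hn) :
    fourthMap hm (c • φ) = c • fourthMap hm φ :=
  toLinearMap_smul c _

lemma exists_isChainMap {hn : 4 ≤ n} (hm : 4 ≤ m) (φ : K.rep m hn ⟶ K'.rep m hn) :
    ∃ f₂ f₃, K.IsChainMap K' (firstMap hm φ) f₂ f₃ (fourthMap hm φ) :=
  ⟨toLinearMap (component φ 1 (by lia)), toLinearMap (component φ 2 (by lia)),
    { map_shift := toLinearMap_intertwines _
      map_incl₁ := LinearMap.congr_fun (congrArg toLinearMap (component_succ φ 0 (by lia)))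
      map_incl₂ := LinearMap.congr_fun (congrArg toLinearMap (component_succ φ 1 (by lia)))
      map_incl₃ := LinearMap.congr_fun (congrArg toLinearMap (component_succ φ 2 (by lia))) }⟩

section Morphisms

variable {γ : Z →ₗ[k] Z'} {τ : T →ₗ[k] T'} {π : P →ₗ[k] P'}

/-- The maps between the modules of two sequences given by a morphism from `K` to `K'`. -/
noncomputable def IsHom.stageMap (h : K.IsHom K' γ τ π) (hn : 4 ≤ n) :
    ∀ i, K.stage hn i ⟶ K'.stage hn i
  | 0 => homOfIntertwining π fun _ => map_zero π
  | 1 => homOfIntertwining (γ.prodMap τ) h.diag₂_shift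
  | 2 => homOfIntertwining (diag₃ γ τ) h.diag₃_shift
  | _ + 3 => homOfIntertwining (diag₄ γ τ) h.isChainMap.map_shift

/-- The morphism of representations given by a morphism from `K` to `K'`. -/
noncomputable def IsHom.repMap (h : K.IsHom K' γ τ π) (hn : 4 ≤ n) :
    K.rep m hn ⟶ K'.rep m hn :=
  sequenceRep.map (h.stageMap hn) fun i =>
    match i with
    | 0 => toLinearMap_injective (LinearMap.ext h.isChainMap.map_incl₁)
    | 1 => toLinearMap_injective (LinearMap.ext h.isChainMap.map_incl₂)
    | 2 => toLinearMap_injective (LinearMap.ext h.isChainMap.map_incl₃)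
    | _ + 3 => rfl

lemma IsHom.isShortExact_stageMap {Z'' T'' P'' : Type u} [AddCommGroup Z''] [Module k Z'']
    [AddCommGroup T''] [Module k T''] [AddCommGroup P''] [Module k P'']
    {K'' : ExtendedKronecker k Z'' T'' P''} {γ' : Z' →ₗ[k] Z''} {τ' : T' →ₗ[k] T''}
    {π' : P' →ₗ[k] P''} (h : K.IsHom K' γ τ π) (h' : K'.IsHom K'' γ' τ' π')
    (hγ : IsShortExact γ γ') (hτ : IsShortExact τ τ') (hπ : IsShortExact π π') (hn : 4 ≤ n)
    (i : ℕ) : IsShortExact (h.stageMap hn i).hom (h'.stageMap hn i).hom :=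
  match i with
  | 0 => hπ
  | 1 => hγ.prodMap hτ
  | 2 => hγ.prodMap ((hγ.prodMap hγ).prodMap hτ)
  | _ + 3 => hγ.prodMap ((hγ.prodMap hγ).prodMap ((hγ.prodMap hγ).prodMap hτ))

end Morphisms

end ExtendedKronecker

end ModuleSequences

section ExtendedKroneckerOfLoops

namespace ExtendedKronecker

variable {R V V' : Type*} [Ring R] [AddCommGroup V] [Module R V] [AddCommGroup V'] [Module R V']

/-- The representation of the extended Kronecker quiver that encodes a pair of operators on `V`. -/
def ofLoops (A B : Module.End R V) : ExtendedKronecker R (V × V) (V × V × V) V where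
  a := LinearMap.id.prodMap (LinearMap.id.prod A)
  b := .inr R V (V × V)
  c := LinearMap.id.prod (.inr R V V ∘ₗ B)
  injective_add := by
    rintro ⟨x, y⟩ ⟨x', y'⟩ h
    obtain rfl : x = x' := by simpa using congrArg (fun t => t.1) h
    have hy : y = y' := by simpa using congrArg (fun t => t.2.1) h
    rw [hy]
  surjective_coprod := fun ⟨x, w⟩ => ⟨((x, 0), w), by simp⟩
  injective_c _ _ h := congrArg Prod.fst h

variable {A B : Module.End R V} {A' B' : Module.End R V'}

lemma isHom_ofLoops {π : V →ₗ[R] V'} (hA : π ∘ₗ A = A' ∘ₗ π) (hB : π ∘ₗ B = B' ∘ₗ π) :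
    (ofLoops A B).IsHom (ofLoops A' B') (π.prodMap π) (π.prodMap (π.prodMap π)) π where
  map_a z := by simpa [ofLoops] using LinearMap.congr_fun hA z.2
  map_b z := by simp [ofLoops]
  map_c v := by simpa [ofLoops] using LinearMap.congr_fun hB v

namespace IsHom

variable {γ : V × V →ₗ[R] V' × V'} {τ : V × V × V →ₗ[R] V' × V' × V'} {π : V →ₗ[R] V'}
  (h : (ofLoops A B).IsHom (ofLoops A' B') γ τ π)
include h

lemma ofLoops_fst_map_inr (y : V) : (γ (0, y)).1 = 0 := by
  have := (h.map_a (0, y)).symm.trans (h.map_b (y, A y))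
  exact congrArg Prod.fst this

lemma ofLoops_map_graph (y : V) : γ (y, A y) = ((γ (0, y)).2, A' (γ (0, y)).2) := by
  have := (h.map_a (0, y)).symm.trans (h.map_b (y, A y))
  exact (congrArg Prod.snd this).symm

lemma ofLoops_map_c (v : V) : (ofLoops A' B').c (π v) =
    (ofLoops A' B').a (γ (v, 0)) + (ofLoops A' B').b (γ (0, B v)) := by
  rw [← h.map_a, ← h.map_b, ← h.map_c, ← map_add]
  simp [ofLoops]

lemma ofLoops_map_inl (v : V) : γ (v, 0) = (π v, 0) := by
  have hv := h.ofLoops_map_c v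
  refine Prod.ext ?_ ?_
  · simpa [ofLoops] using congrArg (fun t => t.1) hv.symm
  · simpa [ofLoops, h.ofLoops_fst_map_inr] using congrArg (fun t => t.2.1) hv.symm

lemma ofLoops_map_inr (y : V) : γ (0, y) = (0, π y) := by
  have hy : γ (y, A y) = γ (y, 0) + γ (0, A y) := by simp [← map_add]
  rw [h.ofLoops_map_graph, h.ofLoops_map_inl] at hy
  refine Prod.ext (h.ofLoops_fst_map_inr y) ?_
  simpa [h.ofLoops_fst_map_inr] using congrArg Prod.fst hy

lemma eq_prodMap_of_ofLoops : γ = π.prodMap π := by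
  ext <;> simp [h.ofLoops_map_inl, h.ofLoops_map_inr]

lemma comp_left_of_ofLoops : π ∘ₗ A = A' ∘ₗ π := by
  ext y
  simpa [h.eq_prodMap_of_ofLoops] using h.ofLoops_map_graph y

lemma comp_right_of_ofLoops : π ∘ₗ B = B' ∘ₗ π := by
  ext v
  have hv := h.ofLoops_map_c v
  rw [h.eq_prodMap_of_ofLoops] at hv
  simpa [ofLoops] using hv.symm

end IsHom

end ExtendedKronecker

end ExtendedKroneckerOfLoops

section WildFunctor

open ExtendedKronecker TwoLoopQuiver

variable {k : Type u} [Field k] {m n : ℕ}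

variable (k) in
/-- The functor that sends a pair of operators to the sequence of modules over `k[x]/(x^n)` defined
by the corresponding representation of the extended Kronecker quiver. -/
noncomputable def wildFunctor (hm : 4 ≤ m) (hn : 4 ≤ n) :
    (repFg TwoLoopQuiver k).FullSubcategory ⥤
      (monoCat (LinearQuiver m) (TruncatedPolynomial k n)).FullSubcategory where
  obj X := ⟨(ofLoops (loop X.obj 0) (loop X.obj 1)).rep m hn,
    have : Module.Finite k (space X.obj) := X.property _
    rep_mem_monoCat hn⟩
  map h := ObjectProperty.homMk
    ((isHom_ofLoops (spaceMap_loop h.hom 0) (spaceMap_loop h.hom 1)).repMap hn)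
  map_id _ := ObjectProperty.hom_ext _ (fourthMap_injective hm rfl)
  map_comp _ _ := ObjectProperty.hom_ext _ (fourthMap_injective hm rfl)

namespace wildFunctor

variable {hm : 4 ≤ m} {hn : 4 ≤ n} {X : (repFg TwoLoopQuiver k).FullSubcategory}

instance : (wildFunctor k hm hn).Additive where
  map_add := ObjectProperty.hom_ext _ (fourthMap_injective hm rfl)

instance : (wildFunctor k hm hn).Linear k where
  map_smul f c := ObjectProperty.hom_ext _ (fourthMap_injective hm
    (fourthMap_smul hm c ((wildFunctor k hm hn).map f).hom).symm)

lemma isExactBetween : IsExactBetween (wildFunctor k hm hn) := by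
  intro S hS
  have h : IsShortExact (spaceMap S.f.hom) (spaceMap S.g.hom) :=
    (shortExact_moduleCat_iff _).1 ((shortExact_iff_evaluation _).1 hS
      ((Paths.of TwoLoopQuiver).obj (Quiver.SingleObj.star (Fin 2))))
  rw [shortExact_iff_evaluation]
  intro i
  rw [shortExact_moduleCat_iff]
  exact (isHom_ofLoops (spaceMap_loop S.f.hom 0) (spaceMap_loop S.f.hom 1)).isShortExact_stageMap
    (isHom_ofLoops (spaceMap_loop S.g.hom 0) (spaceMap_loop S.g.hom 1))
    (h.prodMap h) (h.prodMap (h.prodMap h)) h hn _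

/-- The retraction of `wildFunctor` that restricts a morphism to the first modules. -/
noncomputable def homRetraction : HomRetraction (wildFunctor k hm hn) where
  retract {X Y} :=
    { toFun φ := ObjectProperty.homMk (homOfSpaceMap (firstMap hm φ.hom) fun i => by
        obtain ⟨f₂, f₃, h⟩ := exists_isChainMap hm φ.hom
        fin_cases i
        · exact h.isHom.comp_left_of_ofLoops
        · exact h.isHom.comp_right_of_ofLoops)
      map_zero' := rfl
      map_add' _ _ := rfl }
  retract_map _ := rfl
  retract_comp _ _ := rfl

lemma eq_zero_of_retract_eq_zero (p : (wildFunctor k hm hn).obj X ⟶ (wildFunctor k hm hn).obj X)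
    (hp : p ≫ p = p) (h0 : homRetraction.retract p = 0) : p = 0 := by
  obtain ⟨f₂, f₃, h⟩ := exists_isChainMap hm p.hom
  have hfirst : firstMap hm p.hom = 0 := congrArg (fun f => spaceMap f.hom) h0
  have hbase : h.base = 0 := by
    rw [h.isHom.eq_prodMap_of_ofLoops, hfirst, LinearMap.prodMap_zero]
  have hp' : p.hom ≫ p.hom = p.hom := congrArg InducedCategory.Hom.hom hp
  have hfourth : IsIdempotentElem (fourthMap hm p.hom) := congrArg (fourthMap hm) hp'
  exact ObjectProperty.hom_ext _
    (fourthMap_injective hm (h.eq_zero_of_base_eq_zero hfourth hbase))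

end wildFunctor

end WildFunctor

theorem theorem4p1_general (k : Type u) [Field k] {m n : ℕ} (hm : 4 ≤ m) (hn : 4 ≤ n) :
    IsWild k (monoCat (LinearQuiver m) (TruncatedPolynomial k n)) :=
  ⟨wildFunctor k hm hn, inferInstance, inferInstance, wildFunctor.homRetraction.faithful,
    wildFunctor.isExactBetween,
    fun _ hX => wildFunctor.homRetraction.isIndecomposable_obj hX
      wildFunctor.eq_zero_of_retract_eq_zero,
    fun _ _ ⟨φ⟩ => ⟨wildFunctor.homRetraction.retractIso φ⟩⟩

theorem theorem4p1 (k : Type u) [Field k] :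
    IsWild k (monoCat (LinearQuiver 4) (TruncatedPolynomial k 4)) :=
  theorem4p1_general k le_rfl le_rfl
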